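/- All manifolds and maps are smooth; manifolds are finite-dimensional, Hausdorff, second countable and connected. Let $\pi:Y\to X$ be a fibred manifold (a surjective submersion), $n=\dim X$, with fibred coordinates $(x^\lambda,y^i)$; let $J^1Y$ be its first order jet manifold, with adapted coordinates $(x^\lambda,y^i,y^i_\lambda)$, and let $$\Pi=\textstyle\bigwedge^nT^*X\otimes_Y TX\otimes_Y V^*Y$$ be its Legendre manifold, with coordinates $(x^\lambda,y^i,p^\lambda_i)$. Put $\omega=dx^1\wedge\dots\wedge dx^n$ and $\omega_\lambda=\partial_\lambda\rfloor\omega$. Let $L=\mathcal L(x^\mu,y^i,y^i_\mu)\,\omega$ be a first order Lagrangian density on $J^1Y$, let $\pi^\lambda_i=\partial\mathcal L/\partial y^i_\lambda$, let $\widehat L:J^1Y\to\Pi$, $p^\lambda_i\circ\widehat L=\pi^\lambda_i$, be its Legendre morphism over $Y$, and let $Q=\widehat L(J^1Y)$ be the constraint space. Assume that $L$ is semiregular: for every $q\in Q$ the preimage $\widehat L^{-1}(q)$ is a connected submanifold of $J^1Y$. A Hamiltonian form is an $n$-form on $\Pi$ which in all fibred coordinates has the expression $H=p^\lambda_i\,dy^i\wedge\omega_\lambda-\mathcal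 H(x^\mu,y^i,p^\mu_i)\,\omega$ with $\mathcal H$ smooth; it defines the momentum morphism $\widehat H:\Pi\to J^1Y$ over $Y$, $y^i_\lambda\circ\widehat H=\partial\mathcal H/\partial p^\lambda_i$. For a morphism $\Phi:\Pi\to J^1Y$ over $Y$ put $H_\Phi=p^\lambda_i\,dy^i\wedge\omega_\lambda-p^\lambda_i\Phi^i_\lambda\,\omega$, where $\Phi^i_\lambda=y^i_\lambda\circ\Phi$. The form $H$ is associated with $L$ if $$\widehat L\circ\widehat H|_Q=\mathrm{Id}_Q\qquad\text{and}\qquad H=H_{\widehat H}+L\circ\widehat H .$$ Then: 1. any two Hamiltonian forms associated with $L$ coincide at every point of $Q$; 2. for every Hamiltonian form $H$ associated with $L$, the Poincaré–Cartan form $\Xi_L=\pi^\lambda_i\,dy^i\wedge\omega_\lambda-\pi^\lambda_iy^i_\lambda\,\omega+\mathcal L\,\omega$ on $J^1Y$ is the pullback $\Xi_L=H\circ\widehat L$, where both forms are regarded as maps into $\bigwedge^nT^*Y$; in every system of fibred coordinates, $$\pi^\lambda_iy^i_\lambda-\mathcal L(x^\mu,y^i,y^i_\mu)=\mathcal H(x^\mu,y^i,\pi^\mu_i)\qquad\text{on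 } J^1Y .$$ -/

import Mathlib

open Set Function
open scoped Manifold ContDiff

noncomputable section

namespace FieldTheory

universe u v

/-- The Euclidean model space `ℝᵏ`. -/
abbrev E (k : ℕ) : Type := EuclideanSpace ℝ (Fin k)

variable {n m : ℕ}
  {X : Type u} [TopologicalSpace X] [ChartedSpace (E n) X]
  {Y : Type v} [TopologicalSpace Y] [ChartedSpace (E n × E m) Y]

/-- The tangent space `T_x X` of the base. Mathlib's `TangentSpace 𝓘(ℝ, E n) x` is by definition
the model space `E n`; the latter is used directly since it carries a norm. -/
abbrev TanBase (n : ℕ) {X : Type u} (_x : X) : Type := E n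

/-- The tangent space `T_y Y` of the total space (by definition the model space). -/
abbrev TanTotal (n m : ℕ) {Y : Type v} (_y : Y) : Type := E n × E m

/-- The differential `T_y π : T_y Y → T_{π y} X`. -/
def tanProj (π : Y → X) (y : Y) : TanTotal n m y →L[ℝ] TanBase n (π y) :=
  mfderiv 𝓘(ℝ, E n × E m) 𝓘(ℝ, E n) π y

/-- The vertical tangent space `V_y Y = ker T_y π`, as a subspace of `T_y Y`. -/
def vertSubspace (n m : ℕ) {X : Type u} [TopologicalSpace X] [ChartedSpace (E n) X]
    {Y : Type v} [TopologicalSpace Y] [ChartedSpace (E n × E m) Y] (π : Y → X) (y : Y) :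
    Submodule ℝ (E n × E m) :=
  LinearMap.ker (tanProj (n := n) (m := m) π y).toLinearMap

/-- The vertical tangent space `V_y Y`, as a normed space. -/
def Vert (n m : ℕ) {X : Type u} [TopologicalSpace X] [ChartedSpace (E n) X]
    {Y : Type v} [TopologicalSpace Y] [ChartedSpace (E n × E m) Y] (π : Y → X) (y : Y) : Type :=
  vertSubspace n m π y

instance (π : Y → X) (y : Y) : NormedAddCommGroup (Vert n m π y) :=
  inferInstanceAs (NormedAddCommGroup (vertSubspace n m π y))

instance (π : Y → X) (y : Y) : NormedSpace ℝ (Vert n m π y) :=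
  inferInstanceAs (NormedSpace ℝ (vertSubspace n m π y))

/-- The inclusion `V_y Y → T_y Y`. -/
def Vert.incl (π : Y → X) (y : Y) : Vert n m π y →L[ℝ] TanTotal n m y :=
  (vertSubspace n m π y).subtypeL

theorem Vert.tanProj_incl (π : Y → X) (y : Y) (w : Vert n m π y) :
    tanProj π y (Vert.incl π y w) = 0 :=
  LinearMap.mem_ker.mp (Subtype.property (p := fun w => w ∈ vertSubspace n m π y) w)

/-- The fibre `J¹_y Y` of the first order jet manifold: a 1-jet at `π y` of a section `s` with
`s (π y) = y` is identified with its tangent map `T_{π y} X → T_y Y`, which is an arbitrary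
right inverse of `T_y π` (the contact map). -/
def Jet (π : Y → X) (y : Y) : Type :=
  {Γ : TanBase n (π y) →L[ℝ] TanTotal n m y //
    (tanProj π y).comp Γ = ContinuousLinearMap.id ℝ (E n)}

/-- The total space `J¹Y`. -/
abbrev J1 (π : Y → X) : Type v := Σ y : Y, Jet (n := n) (m := m) π y

/-- The affine action of `T*_{π y} X ⊗ V_y Y` on `J¹_y Y`. -/
def Jet.add {π : Y → X} {y : Y} (Γ : Jet (n := n) (m := m) π y)
    (σ : TanBase n (π y) →L[ℝ] Vert n m π y) : Jet (n := n) (m := m) π y :=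
  ⟨Γ.1 + (Vert.incl π y).comp σ, by
    ext1 v
    have h1 : tanProj π y (Γ.1 v) = v := by
      have := congrArg (fun f => f v) Γ.2
      simpa using this
    have h2 := Vert.tanProj_incl π y (σ v)
    simp [h1, h2]⟩

/-- The space `⋀ⁿ T*_x X` of densities at a point of the base. -/
abbrev Density (n : ℕ) {X : Type u} (x : X) : Type := (TanBase n x) [⋀^Fin n]→L[ℝ] ℝ

/-- The space `⋀ⁿ T*_y Y` of exterior `n`-forms at a point of the total space. -/
abbrev FormAt (n m : ℕ) {Y : Type v} (y : Y) : Type := (TanTotal n m y) [⋀^Fin n]→L[ℝ] ℝ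

/-- The fibre over `y` of the Legendre manifold `Π = ⋀ⁿ T*X ⊗ TX ⊗ V*Y`, written as the space of
linear maps `T*_{π y} X ⊗ V_y Y → ⋀ⁿ T*_{π y} X`: the tensor `ω ⊗ w ⊗ α` is the map
`σ ↦ α (σ w) • ω`. -/
abbrev Leg (π : Y → X) (y : Y) : Type :=
  (TanBase n (π y) →L[ℝ] Vert n m π y) →L[ℝ] Density n (π y)

/-- The total space of the Legendre manifold `Π`. -/
abbrev LegendreManifold (π : Y → X) : Type v := Σ y : Y, Leg (n := n) (m := m) π y

/-- The exterior product `α₁ ∧ ⋯ ∧ αₙ` of `n` covectors, normalized by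
`(α₁ ∧ ⋯ ∧ αₙ) (v₁, …, vₙ) = det (α_a (v_b))`. -/
def wedge {V : Type*} [NormedAddCommGroup V] [NormedSpace ℝ V] (α : Fin n → V →L[ℝ] ℝ) :
    V [⋀^Fin n]→L[ℝ] ℝ :=
  { Matrix.detRowAlternating.compLinearMap
      (LinearMap.pi fun a => (α a).toLinearMap : V →ₗ[ℝ] Fin n → ℝ) with
    cont := by
      change Continuous fun v : Fin n → V => Matrix.det (Matrix.of fun b a => α a (v b))
      exact Continuous.matrix_det (by fun_prop) }

/-- Fibred coordinates `(x^λ, y^i)` on `Y → X`: a smooth chart of `Y` and a smooth chart of `X`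
in which `π` is the projection `(x, y) ↦ x`. -/
structure FibredChart (n m : ℕ) {X : Type u} [TopologicalSpace X] [ChartedSpace (E n) X]
    {Y : Type v} [TopologicalSpace Y] [ChartedSpace (E n × E m) Y] (π : Y → X) where
  /-- the chart of the total space -/
  tot : OpenPartialHomeomorph Y (E n × E m)
  /-- the chart of the base -/
  base : OpenPartialHomeomorph X (E n)
  tot_mem : tot ∈ IsManifold.maximalAtlas 𝓘(ℝ, E n × E m) ∞ Y
  base_mem : base ∈ IsManifold.maximalAtlas 𝓘(ℝ, E n) ∞ X
  mapsTo : ∀ y ∈ tot.source, π y ∈ base.source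
  fst_eq : ∀ y ∈ tot.source, (tot y).1 = base (π y)

/-- Coordinates `y^i_λ` on the fibres of `J¹Y`. -/
abbrev JetCoord (n m : ℕ) : Type := Fin m → Fin n → ℝ

/-- Coordinates `p^λ_i` on the fibres of `Π`. -/
abbrev MomCoord (n m : ℕ) : Type := Fin n → Fin m → ℝ

namespace FibredChart

variable {π : Y → X} (c : FibredChart n m π)

/-- The differential at `y` of the chart of `Y`. -/
def dTot (y : Y) : TanTotal n m y →L[ℝ] E n × E m :=
  mfderiv 𝓘(ℝ, E n × E m) 𝓘(ℝ, E n × E m) c.tot y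

/-- The differential at the point `c.tot y` of the inverse of the chart of `Y`. -/
def dTotSymm (y : Y) : E n × E m →L[ℝ] TanTotal n m y :=
  mfderiv 𝓘(ℝ, E n × E m) 𝓘(ℝ, E n × E m) c.tot.symm (c.tot y)

/-- The differential at `x` of the chart of `X`. -/
def dBase (x : X) : TanBase n x →L[ℝ] E n :=
  mfderiv 𝓘(ℝ, E n) 𝓘(ℝ, E n) c.base x

/-- The differential at the point `c.base x` of the inverse of the chart of `X`. -/
def dBaseSymm (x : X) : E n →L[ℝ] TanBase n x :=
  mfderiv 𝓘(ℝ, E n) 𝓘(ℝ, E n) c.base.symm (c.base x)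

/-- The coordinate vector `∂_λ = ∂/∂x^λ` in `T_x X`. -/
def partialX (x : X) (l : Fin n) : TanBase n x :=
  c.dBaseSymm x (EuclideanSpace.single l 1)

/-- The covector `dx^λ` in `T*_x X`. -/
def dxBase (x : X) (l : Fin n) : TanBase n x →L[ℝ] ℝ :=
  (EuclideanSpace.proj l).comp (c.dBase x)

/-- The covector `dx^λ` in `T*_y Y`. -/
def dx (y : Y) (l : Fin n) : TanTotal n m y →L[ℝ] ℝ :=
  ((EuclideanSpace.proj l).comp (ContinuousLinearMap.fst ℝ (E n) (E m))).comp (c.dTot y)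

/-- The covector `dy^i` in `T*_y Y`. -/
def dy (y : Y) (i : Fin m) : TanTotal n m y →L[ℝ] ℝ :=
  ((EuclideanSpace.proj i).comp (ContinuousLinearMap.snd ℝ (E n) (E m))).comp (c.dTot y)

/-- The coordinate vectors `∂/∂y^i` are vertical. -/
theorem dTotSymm_mem_vertSubspace {y : Y} (hy : y ∈ c.tot.source) (w : E m) :
    c.dTotSymm y (0, w) ∈ vertSubspace n m π y := by
  have hz : c.tot y ∈ c.tot.target := c.tot.map_source hy
  have hmem : ∀ᶠ z in nhds (c.tot y), z ∈ c.tot.target := c.tot.open_target.mem_nhds hz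
  have hx : (c.tot y).1 ∈ c.base.target := by
    rw [c.fst_eq y hy]; exact c.base.map_source (c.mapsTo y hy)
  have hsymm : MDifferentiableAt 𝓘(ℝ, E n × E m) 𝓘(ℝ, E n × E m) c.tot.symm (c.tot y) :=
    (contMDiffAt_symm_of_mem_maximalAtlas c.tot_mem hz).mdifferentiableAt (by simp)
  have htot : MDifferentiableAt 𝓘(ℝ, E n × E m) 𝓘(ℝ, E n × E m) c.tot y :=
    (contMDiffAt_of_mem_maximalAtlas c.tot_mem hy).mdifferentiableAt (by simp)
  have hbase : MDifferentiableAt 𝓘(ℝ, E n) 𝓘(ℝ, E n) c.base.symm (c.tot y).1 :=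
    (contMDiffAt_symm_of_mem_maximalAtlas c.base_mem hx).mdifferentiableAt (by simp)
  have hfst : HasMFDerivAt 𝓘(ℝ, E n × E m) 𝓘(ℝ, E n) (Prod.fst : E n × E m → E n) (c.tot y)
      (ContinuousLinearMap.fst ℝ (E n) (E m)) :=
    hasFDerivAt_fst.hasMFDerivAt
  have hπ : MDifferentiableAt 𝓘(ℝ, E n × E m) 𝓘(ℝ, E n) π (c.tot.symm (c.tot y)) := by
    rw [c.tot.left_inv hy]
    refine ((hbase.comp (c.tot y) hfst.mdifferentiableAt).comp y htot).congr_of_eventuallyEq ?_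
    filter_upwards [c.tot.open_source.mem_nhds hy] with y' hy'
    simp [c.fst_eq y' hy', c.base.left_inv (c.mapsTo y' hy')]
  have key : (π ∘ c.tot.symm) =ᶠ[nhds (c.tot y)] (c.base.symm ∘ Prod.fst) := by
    filter_upwards [hmem] with z hz'
    have h := c.tot.map_target hz'
    have h2 := c.fst_eq _ h
    rw [c.tot.right_inv hz'] at h2
    simp [h2, c.base.left_inv (c.mapsTo _ h)]
  have h1 := (hπ.hasMFDerivAt.comp (c.tot y) hsymm.hasMFDerivAt).congr_of_eventuallyEq key.symm
  have h2 := hbase.hasMFDerivAt.comp (c.tot y) hfst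
  have h3 := congrArg (fun f : E n × E m →L[ℝ] E n => f (0, w)) (hasMFDerivAt_unique h1 h2)
  rw [vertSubspace, LinearMap.mem_ker]
  have h4 : mfderiv 𝓘(ℝ, E n × E m) 𝓘(ℝ, E n) π (c.tot.symm (c.tot y)) (c.dTotSymm y (0, w))
      = 0 := by
    refine Eq.trans h3 ?_
    exact map_zero (mfderiv 𝓘(ℝ, E n) 𝓘(ℝ, E n) c.base.symm (c.tot y).1)
  rw [c.tot.left_inv hy] at h4
  exact h4

/-- The coordinate vector `∂_i = ∂/∂y^i` in `V_y Y`. -/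
def partialY {y : Y} (hy : y ∈ c.tot.source) (i : Fin m) : Vert n m π y :=
  ⟨c.dTotSymm y (0, EuclideanSpace.single i 1), c.dTotSymm_mem_vertSubspace hy _⟩

/-- The volume form `ω = dx¹ ∧ ⋯ ∧ dxⁿ` in `⋀ⁿ T*_x X`. -/
def volBase (x : X) : Density n x := wedge (c.dxBase x)

/-- The form `ω = dx¹ ∧ ⋯ ∧ dxⁿ` in `⋀ⁿ T*_y Y`. -/
def vol (y : Y) : FormAt n m y := wedge (c.dx y)

/-- The form `dy^i ∧ ω_λ`, `ω_λ = ∂_λ ⌋ ω`, in `⋀ⁿ T*_y Y`: it is the product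
`dx¹ ∧ ⋯ ∧ dy^i ∧ ⋯ ∧ dxⁿ` in which `dy^i` takes the place of `dx^λ`. -/
def dyWedgeVol (y : Y) (i : Fin m) (l : Fin n) : FormAt n m y :=
  wedge (Function.update (c.dx y) l (c.dy y i))

/-- The coordinates `y^i_λ` of a jet: `Γ = dx^λ ⊗ (∂_λ + y^i_λ ∂_i)`. -/
def jetCoord {y : Y} (Γ : Jet (n := n) (m := m) π y) : JetCoord n m :=
  fun i l => c.dy y i (Γ.1 (c.partialX (π y) l))

/-- The coordinates `p^λ_i` of a point of `Π`: the value of `p` on `dx^λ ⊗ ∂_i` is `p^λ_i ω`. -/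
def momCoord {y : Y} (hy : y ∈ c.tot.source) (p : Leg (n := n) (m := m) π y) : MomCoord n m :=
  fun l i => p ((c.dxBase (π y) l).smulRight (c.partialY hy i)) (c.partialX (π y))

/-- The form `p^λ_i dy^i ∧ ω_λ - h ω` in `⋀ⁿ T*_y Y`. -/
def formOf (y : Y) (p : MomCoord n m) (h : ℝ) : FormAt n m y :=
  (∑ l, ∑ i, p l i • c.dyWedgeVol y i l) - h • c.vol y

end FibredChart

/-- The contraction `p^λ_i v^i_λ`. -/
def contract (p : MomCoord n m) (v : JetCoord n m) : ℝ := ∑ l, ∑ i, p l i * v i l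

/-- `ℒ (x, y, v)` is the local coordinate expression of the field `L` of densities on `J¹Y`:
`L = ℒ ω`, with `ℒ` smooth. -/
def IsLocalLagrangian {π : Y → X} (c : FibredChart n m π)
    (L : (y : Y) → Jet (n := n) (m := m) π y → Density n (π y))
    (ℒ : (E n × E m) × JetCoord n m → ℝ) : Prop :=
  ContDiffOn ℝ ∞ ℒ (c.tot.target ×ˢ univ) ∧
    ∀ y ∈ c.tot.source, ∀ Γ : Jet (n := n) (m := m) π y,
      L y Γ = ℒ (c.tot y, c.jetCoord Γ) • c.volBase (π y)

/-- A first order Lagrangian density: a smooth horizontal density `L` on `J¹Y → X`. -/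
structure Lagrangian (n m : ℕ) {X : Type u} [TopologicalSpace X] [ChartedSpace (E n) X]
    {Y : Type v} [TopologicalSpace Y] [ChartedSpace (E n × E m) Y] (π : Y → X) where
  /-- the density at a point of `J¹Y` -/
  toFun : (y : Y) → Jet (n := n) (m := m) π y → Density n (π y)
  smooth : ∀ c : FibredChart n m π, ∃ ℒ, IsLocalLagrangian c toFun ℒ

/-- The partial derivative `∂ℒ/∂y^i_λ`. -/
def dLag (ℒ : (E n × E m) × JetCoord n m → ℝ) (z : E n × E m) (v : JetCoord n m) :
    MomCoord n m :=
  fun l i => fderiv ℝ (fun v' => ℒ (z, v')) v (Pi.single i (Pi.single l 1))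

/-- The partial derivative `∂ℋ/∂p^λ_i`. -/
def dHam (ℋ : (E n × E m) × MomCoord n m → ℝ) (z : E n × E m) (p : MomCoord n m) :
    JetCoord n m :=
  fun i l => fderiv ℝ (fun p' => ℋ (z, p')) p (Pi.single l (Pi.single i 1))

/-- `ℋ (x, y, p)` is the local coordinate expression of the field `H` of `n`-forms:
`H = p^λ_i dy^i ∧ ω_λ - ℋ ω`, with `ℋ` smooth. -/
def IsLocalHamiltonian {π : Y → X} (c : FibredChart n m π)
    (H : (y : Y) → Leg (n := n) (m := m) π y → FormAt n m y)
    (ℋ : (E n × E m) × MomCoord n m → ℝ) : Prop :=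
  ContDiffOn ℝ ∞ ℋ (c.tot.target ×ˢ univ) ∧
    ∀ y, ∀ hy : y ∈ c.tot.source, ∀ p : Leg (n := n) (m := m) π y,
      H y p = c.formOf y (c.momCoord hy p) (ℋ (c.tot y, c.momCoord hy p))

/-- A multimomentum Hamiltonian form `H = p^λ_i dy^i ∧ ω_λ - ℋ ω` on the Legendre manifold. It is
semibasic over `Y`, so its value at a point of `Π` over `y` is an element of `⋀ⁿ T*_y Y`. -/
structure HamiltonianForm (n m : ℕ) {X : Type u} [TopologicalSpace X] [ChartedSpace (E n) X]
    {Y : Type v} [TopologicalSpace Y] [ChartedSpace (E n × E m) Y] (π : Y → X) where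
  /-- the value of the form at a point of `Π` -/
  toFun : (y : Y) → Leg (n := n) (m := m) π y → FormAt n m y
  smooth : ∀ c : FibredChart n m π, ∃ ℋ, IsLocalHamiltonian c toFun ℋ

variable {π : Y → X}

/-- The Legendre morphism `L̂ : J¹_y Y → Π_y`, the derivative of `L` along the fibres of
`J¹Y → Y`. -/
def Lagrangian.legendre (L : Lagrangian n m π) (y : Y) (Γ : Jet (n := n) (m := m) π y) :
    Leg (n := n) (m := m) π y :=
  fderiv ℝ (fun σ : TanBase n (π y) →L[ℝ] Vert n m π y => L.toFun y (Γ.add σ)) 0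

/-- The Legendre morphism `L̂ : J¹Y → Π`. -/
def Lagrangian.legendreMap (L : Lagrangian n m π) (z : J1 (n := n) (m := m) π) :
    LegendreManifold (n := n) (m := m) π :=
  ⟨z.1, L.legendre z.1 z.2⟩

/-- The constraint space `Q = L̂ (J¹Y)`. -/
def Lagrangian.constraintSpace (L : Lagrangian n m π) :
    Set (LegendreManifold (n := n) (m := m) π) :=
  range L.legendreMap

/-- The adapted coordinates `(x^λ, y^i, y^i_λ)` on `J¹Y`. -/
def FibredChart.jetChart (c : FibredChart n m π) (z : J1 (n := n) (m := m) π) :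
    (E n × E m) × JetCoord n m :=
  (c.tot z.1, c.jetCoord z.2)

/-- `i : M → J¹Y` is a smooth map, with respect to the manifold structure given by the adapted
coordinates. -/
def IsSmoothToJ1 (k : ℕ) {M : Type v} [TopologicalSpace M] [ChartedSpace (E k) M]
    (i : M → J1 (n := n) (m := m) π) : Prop :=
  Continuous (fun q => (i q).1) ∧
    ∀ c : FibredChart n m π,
      ContMDiffOn 𝓘(ℝ, E k) 𝓘(ℝ, (E n × E m) × JetCoord n m) ∞ (fun q => c.jetChart (i q))
        {q | (i q).1 ∈ c.tot.source}

/-- `S` is a connected submanifold of `J¹Y`: the image of a connected manifold under an injective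
smooth immersion (embedded submanifolds are a special case). -/
def IsConnectedSubmanifold (S : Set (J1 (n := n) (m := m) π)) : Prop :=
  ∃ (k : ℕ) (M : Type v) (_ : TopologicalSpace M) (_ : ChartedSpace (E k) M)
    (i : M → J1 (n := n) (m := m) π),
    IsManifold 𝓘(ℝ, E k) ∞ M ∧ T2Space M ∧ SecondCountableTopology M ∧ ConnectedSpace M ∧
    IsSmoothToJ1 k i ∧ Injective i ∧
    (∀ (c : FibredChart n m π) (q : M), (i q).1 ∈ c.tot.source →
      Injective (mfderiv 𝓘(ℝ, E k) 𝓘(ℝ, (E n × E m) × JetCoord n m)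
        (fun q' => c.jetChart (i q')) q)) ∧
    range i = S

/-- A Lagrangian density is semiregular if the preimage `L̂⁻¹(q)` of every point `q` of the
constraint space is a connected submanifold of `J¹Y`. -/
def Lagrangian.IsSemiregular (L : Lagrangian n m π) : Prop :=
  ∀ q ∈ L.constraintSpace, IsConnectedSubmanifold (L.legendreMap ⁻¹' {q})

/-- `Φ` is the momentum morphism `Ĥ : Π → J¹Y` over `Y` defined by `H`:
`y^i_λ ∘ Ĥ = ∂ℋ/∂p^λ_i`. -/
def HamiltonianForm.IsMomentumMorphism (H : HamiltonianForm n m π)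
    (Φ : (y : Y) → Leg (n := n) (m := m) π y → Jet (n := n) (m := m) π y) : Prop :=
  ∀ (c : FibredChart n m π) (ℋ : (E n × E m) × MomCoord n m → ℝ),
    IsLocalHamiltonian c H.toFun ℋ →
    ∀ (y : Y) (hy : y ∈ c.tot.source) (p : Leg (n := n) (m := m) π y),
      c.jetCoord (Φ y p) = dHam ℋ (c.tot y) (c.momCoord hy p)

/-- `H` is associated with `L`: the momentum morphism `Ĥ` of `H` satisfies
`L̂ ∘ Ĥ = Id` on `Q`, and `H = H_Ĥ + L ∘ Ĥ` on all of `Π`, where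
`H_Φ = p^λ_i dy^i ∧ ω_λ - p^λ_i Φ^i_λ ω`. -/
def HamiltonianForm.IsAssociated (H : HamiltonianForm n m π) (L : Lagrangian n m π) : Prop :=
  ∃ Φ : (y : Y) → Leg (n := n) (m := m) π y → Jet (n := n) (m := m) π y,
    H.IsMomentumMorphism Φ ∧
    (∀ q ∈ L.constraintSpace, L.legendreMap ⟨q.1, Φ q.1 q.2⟩ = q) ∧
    (∀ (c : FibredChart n m π) (y : Y) (hy : y ∈ c.tot.source)
      (p : Leg (n := n) (m := m) π y),
      H.toFun y p =
        c.formOf y (c.momCoord hy p) (contract (c.momCoord hy p) (c.jetCoord (Φ y p)))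
          + (L.toFun y (Φ y p)).compContinuousLinearMap (tanProj π y))

/-- The Poincaré–Cartan form `Ξ_L = π^λ_i dy^i ∧ ω_λ - π^λ_i y^i_λ ω + ℒ ω`,
`π^λ_i = ∂ℒ/∂y^i_λ`, in fibred coordinates, as a form in `⋀ⁿ T*_y Y` at a point of `J¹Y`. -/
def FibredChart.poincareCartan (c : FibredChart n m π)
    (ℒ : (E n × E m) × JetCoord n m → ℝ) (y : Y) (Γ : Jet (n := n) (m := m) π y) :
    FormAt n m y :=
  let v := c.jetCoord Γ
  let mom := dLag ℒ (c.tot y) v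
  c.formOf y mom (contract mom v) + ℒ (c.tot y, v) • c.vol y

end FieldTheory

end

/-! The whole argument is a conservation law along the fibres of `L̂`. Fix `q ∈ Q` over `y` with
momentum coordinates `p`, and consider the energy `φ(v) = p·v - ℒ(y, v)` as a function of the jet
coordinates, with `p` frozen. Its differential is `p - ∂ℒ/∂v`, which vanishes exactly where `L̂`
takes the value `q`. Hence `φ` has zero derivative along the submanifold `L̂⁻¹(q)`, and
connectedness makes it constant there (`energy_eq_of_isConnectedSubmanifold`).

If `H` is associated with `L`, then `L̂ ∘ Ĥ = Id` on `Q` puts `Ĥ(q)` in this same fibre, and `H =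
H_Ĥ + L ∘ Ĥ` says that the Hamiltonian function at `q` is `φ` at `Ĥ(q)`. By constancy it is `φ` at
any jet `Γ` with `L̂(Γ) = q`, an expression that involves only `L` (`toFun_legendre`). Uniqueness on
`Q` and the formula for `Ξ_L` both follow; the scalar identity results from comparing coefficients
of `ω ≠ 0`. The rest translates the intrinsic definitions into fibred coordinates. -/

namespace FieldTheory

/-! ### Calculus and linear algebra preliminaries -/

open Topology in
/-- A function with vanishing differential on a manifold without boundary is locally constant. -/
theorem isLocallyConstant_of_mfderiv_eq_zero {V F M : Type*} [NormedAddCommGroup V]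
    [NormedSpace ℝ V] [NormedAddCommGroup F] [NormedSpace ℝ F] [TopologicalSpace M]
    [ChartedSpace V M] [IsManifold 𝓘(ℝ, V) ∞ M] {f : M → F}
    (hf : ∀ x, HasMFDerivAt 𝓘(ℝ, V) 𝓘(ℝ, F) f x 0) : IsLocallyConstant f := by
  rw [IsLocallyConstant.iff_eventually_eq]
  intro q
  set e := chartAt V q
  have hq : q ∈ e.source := mem_chart_source V q
  have he : e ∈ IsManifold.maximalAtlas 𝓘(ℝ, V) ∞ M := IsManifold.chart_mem_maximalAtlas q
  have hg : ∀ z ∈ e.target, HasFDerivAt (f ∘ e.symm) (0 : V →L[ℝ] F) z := by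
    intro z hz
    have h1 : MDifferentiableAt 𝓘(ℝ, V) 𝓘(ℝ, V) e.symm z :=
      (contMDiffAt_symm_of_mem_maximalAtlas he hz).mdifferentiableAt (by simp)
    have h2 := (hf (e.symm z)).comp z h1.hasMFDerivAt
    exact hasMFDerivAt_iff_hasFDerivAt.mp (h2.congr_mfderiv (ContinuousLinearMap.zero_comp _))
  -- The chart target need not be connected; openness of level sets is enough for a local statement.
  have hopen : IsOpen (e.target ∩ (f ∘ e.symm) ⁻¹' {f q}) :=
    e.open_target.isOpen_inter_preimage_of_fderiv_eq_zero
      (fun z hz => (hg z hz).differentiableAt.differentiableWithinAt)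
      (fun z hz => (hg z hz).fderiv) _
  have hmem : e.target ∩ (f ∘ e.symm) ⁻¹' {f q} ∈ 𝓝 (e q) :=
    hopen.mem_nhds ⟨e.map_source hq, by simp [e.left_inv hq]⟩
  filter_upwards [(e.continuousAt hq).preimage_mem_nhds hmem, e.open_source.mem_nhds hq]
    with x hx hxs
  simpa [e.left_inv hxs] using hx.2

variable {n m : ℕ}
  {X : Type u} [TopologicalSpace X] [ChartedSpace (E n) X]
  {Y : Type v} [TopologicalSpace Y] [ChartedSpace (E n × E m) Y] {π : Y → X}

theorem wedge_apply {V : Type*} [NormedAddCommGroup V] [NormedSpace ℝ V]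
    (α : Fin n → V →L[ℝ] ℝ) (v : Fin n → V) :
    wedge α v = Matrix.det (Matrix.of fun b a => α a (v b)) := rfl

/-- A covector basis evaluates to one on its dual basis. -/
theorem wedge_apply_dual {V : Type*} [NormedAddCommGroup V] [NormedSpace ℝ V]
    (α : Fin n → V →L[ℝ] ℝ) (v : Fin n → V)
    (h : ∀ a b, α a (v b) = if a = b then 1 else 0) : wedge α v = 1 := by
  have : (Matrix.of fun b a => α a (v b)) = (1 : Matrix (Fin n) (Fin n) ℝ) := by
    ext b a
    simp [h, Matrix.one_apply, eq_comm]
  rw [wedge_apply, this, Matrix.det_one]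

/-- A linear form on jet coordinates is the contraction with its components. -/
theorem clm_apply_eq_contract (A : JetCoord n m →L[ℝ] ℝ) (u : JetCoord n m) :
    A u = contract (fun l i => A (Pi.single i (Pi.single l 1))) u := by
  have hu : u = ∑ l, ∑ i, u i l • (Pi.single i (Pi.single l 1) : JetCoord n m) := by
    ext i l
    simp only [Finset.sum_apply, Pi.smul_apply, smul_eq_mul]
    rw [Finset.sum_eq_single l, Finset.sum_eq_single i]
    · simp
    · intro j _ hj
      simp [Pi.single_eq_of_ne hj.symm]
    · simp
    · intro k _ hk
      refine Finset.sum_eq_zero fun j _ => ?_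
      rcases eq_or_ne i j with rfl | hj
      · simp [Pi.single_eq_of_ne hk.symm]
      · simp [Pi.single_eq_of_ne hj]
    · simp
  conv_lhs => rw [hu]
  simp [contract, map_sum, mul_comm]

theorem fderiv_eq_contract_dLag (ℒ : (E n × E m) × JetCoord n m → ℝ) (z : E n × E m)
    (v u : JetCoord n m) :
    fderiv ℝ (fun v' => ℒ (z, v')) v u = contract (dLag ℒ z v) u :=
  clm_apply_eq_contract _ u

theorem IsLocalLagrangian.differentiableAt {c : FibredChart n m π}
    {L : (y : Y) → Jet (n := n) (m := m) π y → Density n (π y)}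
    {ℒ : (E n × E m) × JetCoord n m → ℝ} (h : IsLocalLagrangian c L ℒ) {y : Y}
    (hy : y ∈ c.tot.source) (v : JetCoord n m) :
    DifferentiableAt ℝ (fun v' => ℒ (c.tot y, v')) v := by
  have h1 : DifferentiableAt ℝ ℒ (c.tot y, v) :=
    (h.1.contDiffAt ((c.tot.open_target.prod isOpen_univ).mem_nhds
      ⟨c.tot.map_source hy, mem_univ _⟩)).differentiableAt (by simp)
  exact h1.comp v (by fun_prop)

/-! ### Fibred coordinates: dual frames, volume forms, the Legendre morphism -/

namespace FibredChart

variable (c : FibredChart n m π) {y : Y} (hy : y ∈ c.tot.source)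
include hy

theorem dTot_dTotSymm (w : E n × E m) : c.dTot y (c.dTotSymm y w) = w := by
  have h1 : MDifferentiableAt 𝓘(ℝ, E n × E m) 𝓘(ℝ, E n × E m) c.tot.symm (c.tot y) :=
    (contMDiffAt_symm_of_mem_maximalAtlas c.tot_mem (c.tot.map_source hy)).mdifferentiableAt
      (by simp)
  have h2 : MDifferentiableAt 𝓘(ℝ, E n × E m) 𝓘(ℝ, E n × E m) c.tot
      (c.tot.symm (c.tot y)) := by
    rw [c.tot.left_inv hy]
    exact (contMDiffAt_of_mem_maximalAtlas c.tot_mem hy).mdifferentiableAt (by simp)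
  have h3 := (h2.hasMFDerivAt.comp (c.tot y) h1.hasMFDerivAt).congr_of_eventuallyEq
    (f₁ := id) (by
      filter_upwards [c.tot.open_target.mem_nhds (c.tot.map_source hy)] with z hz
      simp [c.tot.right_inv hz])
  have h4 := congrArg (fun f : E n × E m →L[ℝ] E n × E m => f w)
    (hasMFDerivAt_unique h3 (hasMFDerivAt_id (c.tot y)))
  -- The chain rule produces the derivative at `c.tot.symm (c.tot y)`; once it is applied to a
  -- vector, this base point can be rewritten to `y`.
  have h5 : mfderiv 𝓘(ℝ, E n × E m) 𝓘(ℝ, E n × E m) c.tot (c.tot.symm (c.tot y))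
      (c.dTotSymm y w) = w := h4
  rw [c.tot.left_inv hy] at h5
  exact h5

theorem dBase_dBaseSymm (w : E n) : c.dBase (π y) (c.dBaseSymm (π y) w) = w := by
  have hx := c.mapsTo y hy
  have h1 : MDifferentiableAt 𝓘(ℝ, E n) 𝓘(ℝ, E n) c.base.symm (c.base (π y)) :=
    (contMDiffAt_symm_of_mem_maximalAtlas c.base_mem (c.base.map_source hx)).mdifferentiableAt
      (by simp)
  have h2 : MDifferentiableAt 𝓘(ℝ, E n) 𝓘(ℝ, E n) c.base
      (c.base.symm (c.base (π y))) := by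
    rw [c.base.left_inv hx]
    exact (contMDiffAt_of_mem_maximalAtlas c.base_mem hx).mdifferentiableAt (by simp)
  have h3 := (h2.hasMFDerivAt.comp (c.base (π y)) h1.hasMFDerivAt).congr_of_eventuallyEq
    (f₁ := id) (by
      filter_upwards [c.base.open_target.mem_nhds (c.base.map_source hx)] with z hz
      simp [c.base.right_inv hz])
  have h4 := congrArg (fun f : E n →L[ℝ] E n => f w)
    (hasMFDerivAt_unique h3 (hasMFDerivAt_id (c.base (π y))))
  have h5 : mfderiv 𝓘(ℝ, E n) 𝓘(ℝ, E n) c.base (c.base.symm (c.base (π y)))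
      (c.dBaseSymm (π y) w) = w := h4
  rw [c.base.left_inv hx] at h5
  exact h5

theorem dBase_tanProj (v : E n × E m) :
    c.dBase (π y) (tanProj π y v) = (c.dTot y v).1 := by
  have hx := c.mapsTo y hy
  have hxt : (c.tot y).1 ∈ c.base.target := by
    rw [c.fst_eq y hy]; exact c.base.map_source hx
  have htot : MDifferentiableAt 𝓘(ℝ, E n × E m) 𝓘(ℝ, E n × E m) c.tot y :=
    (contMDiffAt_of_mem_maximalAtlas c.tot_mem hy).mdifferentiableAt (by simp)
  have hsymm : MDifferentiableAt 𝓘(ℝ, E n) 𝓘(ℝ, E n) c.base.symm (c.tot y).1 :=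
    (contMDiffAt_symm_of_mem_maximalAtlas c.base_mem hxt).mdifferentiableAt (by simp)
  have hbase : MDifferentiableAt 𝓘(ℝ, E n) 𝓘(ℝ, E n) c.base (π y) :=
    (contMDiffAt_of_mem_maximalAtlas c.base_mem hx).mdifferentiableAt (by simp)
  have hfst : HasMFDerivAt 𝓘(ℝ, E n × E m) 𝓘(ℝ, E n) (Prod.fst : E n × E m → E n) (c.tot y)
      (ContinuousLinearMap.fst ℝ (E n) (E m)) :=
    hasFDerivAt_fst.hasMFDerivAt
  -- Differentiability of `π` comes from the chart itself: near `y`, `π` is `base.symm ∘ fst ∘ tot`.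
  have hπ : MDifferentiableAt 𝓘(ℝ, E n × E m) 𝓘(ℝ, E n) π y := by
    refine ((hsymm.comp (c.tot y) hfst.mdifferentiableAt).comp y htot).congr_of_eventuallyEq ?_
    filter_upwards [c.tot.open_source.mem_nhds hy] with y' hy'
    simp [c.fst_eq y' hy', c.base.left_inv (c.mapsTo y' hy')]
  have h1 := (hbase.hasMFDerivAt.comp y hπ.hasMFDerivAt).congr_of_eventuallyEq
    (f₁ := Prod.fst ∘ c.tot) (by
      filter_upwards [c.tot.open_source.mem_nhds hy] with y' hy'
      exact c.fst_eq y' hy')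
  exact congrArg (fun f : E n × E m →L[ℝ] E n => f v)
    (hasMFDerivAt_unique h1 (hfst.comp y htot.hasMFDerivAt))

theorem dxBase_partialX (a b : Fin n) :
    c.dxBase (π y) a (c.partialX (π y) b) = if a = b then 1 else 0 := by
  have h := congrArg (fun w : E n => w a) (c.dBase_dBaseSymm hy (EuclideanSpace.single b 1))
  refine Eq.trans h ?_
  simp [PiLp.single_apply]

theorem dy_partialY (i j : Fin m) :
    c.dy y i (Vert.incl π y (c.partialY hy j)) = if i = j then 1 else 0 := by
  have h := congrArg (fun w : E n × E m => w.2 i)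
    (c.dTot_dTotSymm hy (0, EuclideanSpace.single j 1))
  refine Eq.trans h ?_
  simp [PiLp.single_apply]

theorem volBase_partialX : c.volBase (π y) (c.partialX (π y)) = 1 :=
  wedge_apply_dual _ _ (c.dxBase_partialX hy)

theorem vol_ne_zero : c.vol y ≠ 0 := by
  intro h
  have h1 : c.vol y (fun b => c.dTotSymm y (EuclideanSpace.single b 1, 0)) = 1 := by
    refine wedge_apply_dual _ _ fun a b => ?_
    have h := congrArg (fun w : E n × E m => w.1 a)
      (c.dTot_dTotSymm hy (EuclideanSpace.single b 1, 0))
    refine Eq.trans h ?_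
    simp [PiLp.single_apply]
  rw [h] at h1
  simp at h1

/-- Each `dx^λ` on `Y` is the pullback of `dx^λ` on `X`, so the determinants agree entry by entry.
This turns the term `L ∘ Ĥ` into a multiple of `ω` on `Y`. -/
theorem volBase_comp_tanProj :
    (c.volBase (π y)).compContinuousLinearMap (tanProj π y) = c.vol y := by
  ext v
  change Matrix.det _ = Matrix.det _
  congr 1
  ext b a
  exact congrArg (fun w : E n => w a) (c.dBase_tanProj hy (v b))

/-- Since `ω ≠ 0`, the Hamiltonian function can be read off from the form. -/
theorem formOf_injective (p : MomCoord n m) : Injective (c.formOf y p) := by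
  intro h h' e
  have h1 : h • c.vol y = h' • c.vol y := sub_right_injective e
  exact smul_left_injective ℝ (c.vol_ne_zero hy) h1

-- Both `H_Φ + L ∘ Φ` and `Ξ_L` have the shape on the left; the right side exhibits the energy as
-- the coefficient of `ω`.
omit hy in
theorem formOf_add_smul_vol (p : MomCoord n m) (h a : ℝ) :
    c.formOf y p h + a • c.vol y = c.formOf y p (h - a) := by
  have h1 : (h - a) • c.vol y = h • c.vol y - a • c.vol y := sub_smul h a (c.vol y)
  rw [formOf, formOf, h1]
  abel

omit hy in
/-- The linear part of the fibre coordinates of a jet. -/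
noncomputable def jetCoordLinear (y : Y) : (TanBase n (π y) →L[ℝ] Vert n m π y) →L[ℝ] JetCoord n m :=
  ContinuousLinearMap.pi fun i => ContinuousLinearMap.pi fun l =>
    ((c.dy y i).comp (Vert.incl π y)).comp
      (ContinuousLinearMap.apply ℝ (Vert n m π y) (c.partialX (π y) l))

-- The jet coordinates are affine along the fibre, so the fibre derivative defining `L̂` becomes a
-- derivative in the variables `y^i_λ`.
omit hy in
theorem jetCoord_add (Γ : Jet (n := n) (m := m) π y)
    (σ : TanBase n (π y) →L[ℝ] Vert n m π y) :
    c.jetCoord (Γ.add σ) = c.jetCoord Γ + c.jetCoordLinear y σ := by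
  ext i l
  exact map_add (c.dy y i) _ _

theorem jetCoordLinear_smulRight (l : Fin n) (i : Fin m) :
    c.jetCoordLinear y ((c.dxBase (π y) l).smulRight (c.partialY hy i)) =
      Pi.single i (Pi.single l 1) := by
  ext j k
  have h1 : c.jetCoordLinear y ((c.dxBase (π y) l).smulRight (c.partialY hy i)) j k =
      c.dxBase (π y) l (c.partialX (π y) k) * c.dy y j (Vert.incl π y (c.partialY hy i)) := by
    change c.dy y j (Vert.incl π y (c.dxBase (π y) l (c.partialX (π y) k) • c.partialY hy i)) = _
    rw [map_smul, map_smul, smul_eq_mul]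
  rw [h1, c.dxBase_partialX hy, c.dy_partialY hy]
  rcases eq_or_ne j i with rfl | hj
  · rcases eq_or_ne k l with rfl | hk
    · simp
    · simp [hk, hk.symm]
  · simp [hj]

/-- In coordinates the Legendre morphism is `p^λ_i = ∂ℒ/∂y^i_λ`. -/
theorem momCoord_legendre {L : Lagrangian n m π} {ℒ : (E n × E m) × JetCoord n m → ℝ}
    (h : IsLocalLagrangian c L.toFun ℒ) (Γ : Jet (n := n) (m := m) π y) :
    c.momCoord hy (L.legendre y Γ) = dLag ℒ (c.tot y) (c.jetCoord Γ) := by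
  have hL : (fun σ : TanBase n (π y) →L[ℝ] Vert n m π y => L.toFun y (Γ.add σ)) =
      fun σ => ℒ (c.tot y, c.jetCoord Γ + c.jetCoordLinear y σ) • c.volBase (π y) := by
    ext1 σ
    rw [h.2 y hy, c.jetCoord_add]
  have hA : HasFDerivAt
      (fun σ : TanBase n (π y) →L[ℝ] Vert n m π y => c.jetCoord Γ + c.jetCoordLinear y σ)
      (c.jetCoordLinear y) 0 := (c.jetCoordLinear y).hasFDerivAt.const_add _
  have hd : HasFDerivAt (fun v' => ℒ (c.tot y, v'))
      (fderiv ℝ (fun v' => ℒ (c.tot y, v')) (c.jetCoord Γ))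
      (c.jetCoord Γ + c.jetCoordLinear y 0) := by
    rw [map_zero, add_zero]
    exact (h.differentiableAt hy _).hasFDerivAt
  have hleg : L.legendre y Γ =
      ((fderiv ℝ (fun v' => ℒ (c.tot y, v')) (c.jetCoord Γ)).comp
        (c.jetCoordLinear y)).smulRight (c.volBase (π y)) := by
    unfold Lagrangian.legendre
    rw [hL]
    exact ((hd.comp 0 hA).smul_const (c.volBase (π y))).fderiv
  ext l i
  rw [momCoord, hleg, dLag, ContinuousLinearMap.smulRight_apply,
    ContinuousLinearMap.comp_apply, c.jetCoordLinear_smulRight hy]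
  -- `momCoord` evaluates the density on the frame `∂_λ`, where `ω` equals one.
  refine Eq.trans (congrArg (_ * ·) (c.volBase_partialX hy)) (mul_one _)

end FibredChart

/-! ### Constancy of the energy on the fibres of the Legendre morphism -/

/-- The base point of `z` is only propositionally `y`; eliminating the equality in the total space
handles base point and momentum together. -/
theorem momCoord_eq_of_legendreMap_eq {c : FibredChart n m π} {L : Lagrangian n m π}
    {ℒ : (E n × E m) × JetCoord n m → ℝ} (h : IsLocalLagrangian c L.toFun ℒ) {y : Y}
    (hy : y ∈ c.tot.source) {p : Leg (n := n) (m := m) π y} {z : J1 (n := n) (m := m) π}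
    (hz : L.legendreMap z = ⟨y, p⟩) :
    dLag ℒ (c.tot y) (c.jetCoord z.2) = c.momCoord hy p := by
  obtain ⟨y', Γ⟩ := z
  cases hz
  exact (c.momCoord_legendre hy h Γ).symm

/-- The energy `p^λ_i y^i_λ - ℒ` is constant on a connected submanifold on which the Legendre
morphism takes the constant value `p`. -/
theorem energy_eq_of_isConnectedSubmanifold {c : FibredChart n m π} {L : Lagrangian n m π}
    {ℒ : (E n × E m) × JetCoord n m → ℝ} (h : IsLocalLagrangian c L.toFun ℒ) {y : Y}
    (hy : y ∈ c.tot.source) {p : Leg (n := n) (m := m) π y}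
    (hS : IsConnectedSubmanifold (L.legendreMap ⁻¹' {⟨y, p⟩}))
    {z z' : J1 (n := n) (m := m) π} (hz : L.legendreMap z = ⟨y, p⟩)
    (hz' : L.legendreMap z' = ⟨y, p⟩) :
    contract (c.momCoord hy p) (c.jetCoord z.2) - ℒ (c.tot y, c.jetCoord z.2) =
      contract (c.momCoord hy p) (c.jetCoord z'.2) - ℒ (c.tot y, c.jetCoord z'.2) := by
  obtain ⟨k, M, _, _, i, _, _, _, _, hi, -, -, hrange⟩ := hS
  have hmap : ∀ q, L.legendreMap (i q) = ⟨y, p⟩ := fun q => by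
    have : i q ∈ L.legendreMap ⁻¹' {⟨y, p⟩} := hrange ▸ mem_range_self q
    exact this
  set φ : JetCoord n m → ℝ :=
    fun w => contract (c.momCoord hy p) w - ℒ (c.tot y, w)
  have hφd : ∀ w, dLag ℒ (c.tot y) w = c.momCoord hy p →
      HasFDerivAt φ (0 : JetCoord n m →L[ℝ] ℝ) w := by
    intro w hw
    have h1 := (h.differentiableAt hy w).hasFDerivAt
    -- At a critical `w` the frozen `p` is the differential of `ℒ` at `w`, so `φ` is this linear map
    -- minus `ℒ` and the two derivatives cancel.
    have h2 : φ = fun u =>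
        fderiv ℝ (fun v' => ℒ (c.tot y, v')) w u - ℒ (c.tot y, u) := by
      ext u
      rw [fderiv_eq_contract_dLag, hw]
    rw [h2, ← sub_self (fderiv ℝ (fun v' => ℒ (c.tot y, v')) w)]
    exact (ContinuousLinearMap.hasFDerivAt _).sub h1
  -- `L̂` covers the identity of `Y`, so the whole fibre lies over `y` and a single chart suffices.
  have hsource : ∀ q, (i q).1 ∈ c.tot.source := fun q => by
    have : (i q).1 = y := congrArg Sigma.fst (hmap q)
    rwa [this]
  have hsmooth : ∀ q, MDifferentiableAt 𝓘(ℝ, E k) 𝓘(ℝ, JetCoord n m)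
      (fun q => c.jetCoord (i q).2) q := by
    intro q
    have h1 : ContMDiffAt 𝓘(ℝ, E k) 𝓘(ℝ, (E n × E m) × JetCoord n m) ∞
        (fun q => c.jetChart (i q)) q :=
      (hi.2 c).contMDiffAt (Filter.mem_of_superset Filter.univ_mem fun q _ => hsource q)
    have h2 : MDifferentiableAt 𝓘(ℝ, (E n × E m) × JetCoord n m) 𝓘(ℝ, JetCoord n m)
        Prod.snd (c.jetChart (i q)) :=
      (differentiableAt_snd (𝕜 := ℝ)).mdifferentiableAt
    exact h2.comp q (h1.mdifferentiableAt (by simp))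
  have hconst : IsLocallyConstant (fun q => φ (c.jetCoord (i q).2)) := by
    refine isLocallyConstant_of_mfderiv_eq_zero (V := E k) fun q => ?_
    have h1 := (hφd _ (momCoord_eq_of_legendreMap_eq h hy (hmap q))).hasMFDerivAt
    have h2 := h1.comp q (hsmooth q).hasMFDerivAt
    exact h2.congr_mfderiv (ContinuousLinearMap.zero_comp _)
  have hmem : ∀ w, L.legendreMap w = ⟨y, p⟩ → ∃ q, i q = w := fun w hw => by
    have : w ∈ range i := hrange ▸ hw
    exact this
  obtain ⟨q, rfl⟩ := hmem z hz
  obtain ⟨q', rfl⟩ := hmem z' hz'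
  exact hconst.apply_eq_of_preconnectedSpace q q'

/-- On the constraint space an associated Hamiltonian form is determined by the energy. -/
theorem HamiltonianForm.IsAssociated.toFun_legendre {H : HamiltonianForm n m π}
    {L : Lagrangian n m π} (hH : H.IsAssociated L) (hL : L.IsSemiregular)
    {c : FibredChart n m π} {ℒ : (E n × E m) × JetCoord n m → ℝ}
    (h : IsLocalLagrangian c L.toFun ℒ) {y : Y} (hy : y ∈ c.tot.source)
    (Γ : Jet (n := n) (m := m) π y) :
    H.toFun y (L.legendre y Γ) = c.formOf y (c.momCoord hy (L.legendre y Γ))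
      (contract (c.momCoord hy (L.legendre y Γ)) (c.jetCoord Γ) - ℒ (c.tot y, c.jetCoord Γ)) := by
  obtain ⟨Φ, -, hQ, hform⟩ := hH
  have hq : (⟨y, L.legendre y Γ⟩ : LegendreManifold (n := n) (m := m) π) ∈ L.constraintSpace :=
    ⟨⟨y, Γ⟩, rfl⟩
  -- By `hQ`, the jet `Φ q` lies in the same Legendre fibre as `Γ`, so its energy may be replaced by
  -- that of `Γ`.
  rw [hform c y hy, h.2 y hy,
    energy_eq_of_isConnectedSubmanifold h hy (hL _ hq) (z := ⟨y, Γ⟩) rfl (hQ _ hq),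
    ← c.formOf_add_smul_vol, ← c.volBase_comp_tanProj hy]
  rfl

/-! ### Existence of fibred coordinates -/

/-- A smooth submersion has fibred coordinates around every point. -/
theorem exists_fibredChart [IsManifold 𝓘(ℝ, E n × E m) ∞ Y]
    (hπ : Manifold.IsSubmersion 𝓘(ℝ, E n × E m) 𝓘(ℝ, E n) ∞ π) (y : Y) :
    ∃ c : FibredChart n m π, y ∈ c.tot.source := by
  obtain ⟨F, _, _, h⟩ := hπ.isSubmersionAt y
  have e := h.equiv
  have hfin : FiniteDimensional ℝ (E n × F) := e.toLinearEquiv.finiteDimensional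
  have hF : FiniteDimensional ℝ F :=
    FiniteDimensional.of_surjective (LinearMap.snd ℝ (E n) F) Prod.snd_surjective
  -- The complement `F` in the normal form of a submersion is abstract; a dimension count identifies
  -- it with `E m`, and `A` absorbs this identification into the chart.
  have hrank : Module.finrank ℝ F = Module.finrank ℝ (E m) := by
    have := e.toLinearEquiv.finrank_eq
    rw [Module.finrank_prod, Module.finrank_prod] at this
    omega
  let eF : F ≃L[ℝ] E m := ContinuousLinearEquiv.ofFinrankEq hrank
  let A : (E n × E m) ≃L[ℝ] E n × E m :=
    h.equiv.trans ((ContinuousLinearEquiv.refl ℝ (E n)).prodCongr eF)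
  refine ⟨⟨h.domChart.trans A.toHomeomorph.toOpenPartialHomeomorph, h.codChart, ?_,
    h.codChart_mem_maximalAtlas, ?_, ?_⟩, ?_⟩
  · rw [IsManifold.mem_maximalAtlas_iff_contMDiffOn]
    have hA : ContMDiff 𝓘(ℝ, E n × E m) 𝓘(ℝ, E n × E m) ∞ A := A.contDiff.contMDiff
    have hA' : ContMDiff 𝓘(ℝ, E n × E m) 𝓘(ℝ, E n × E m) ∞ A.symm := A.symm.contDiff.contMDiff
    constructor
    · exact hA.comp_contMDiffOn ((contMDiffOn_of_mem_maximalAtlas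
        h.domChart_mem_maximalAtlas).mono fun x hx => hx.1)
    · exact (contMDiffOn_symm_of_mem_maximalAtlas h.domChart_mem_maximalAtlas).comp
        hA'.contMDiffOn fun x hx => hx.2
  · intro x hx
    exact h.source_subset_preimage_source hx.1
  · intro x hx
    have hx' : h.domChart x ∈ (h.domChart.extend 𝓘(ℝ, E n × E m)).target := by
      simpa using h.domChart.map_source hx.1
    have h1 := h.writtenInCharts hx'
    have h2 : h.codChart (π x) = (h.equiv (h.domChart x)).1 := by
      simpa [h.domChart.left_inv hx.1] using h1
    exact h2.symm
  · exact ⟨h.mem_domChart_source, mem_univ _⟩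

end FieldTheory

/-! ### The main theorem -/

theorem proposition8 (n m : ℕ)
    {X : Type*} [TopologicalSpace X] [ChartedSpace (FieldTheory.E n) X]
    [IsManifold 𝓘(ℝ, FieldTheory.E n) ∞ X]
    [T2Space X] [SecondCountableTopology X] [ConnectedSpace X]
    {Y : Type*} [TopologicalSpace Y] [ChartedSpace (FieldTheory.E n × FieldTheory.E m) Y]
    [IsManifold 𝓘(ℝ, FieldTheory.E n × FieldTheory.E m) ∞ Y]
    [T2Space Y] [SecondCountableTopology Y] [ConnectedSpace Y]
    (π : Y → X)
    (hπ : Manifold.IsSubmersion 𝓘(ℝ, FieldTheory.E n × FieldTheory.E m)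
      𝓘(ℝ, FieldTheory.E n) ∞ π)
    (hsurj : Function.Surjective π)
    (L : FieldTheory.Lagrangian n m π) (hL : L.IsSemiregular) :
    (∀ H H' : FieldTheory.HamiltonianForm n m π, H.IsAssociated L → H'.IsAssociated L →
      ∀ q ∈ L.constraintSpace, H.toFun q.1 q.2 = H'.toFun q.1 q.2) ∧
    (∀ H : FieldTheory.HamiltonianForm n m π, H.IsAssociated L →
      ∀ (c : FieldTheory.FibredChart n m π)
        (ℒ : (FieldTheory.E n × FieldTheory.E m) × FieldTheory.JetCoord n m → ℝ),
        FieldTheory.IsLocalLagrangian c L.toFun ℒ →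
        ∀ y ∈ c.tot.source, ∀ Γ : FieldTheory.Jet π y,
          c.poincareCartan ℒ y Γ = H.toFun y (L.legendre y Γ) ∧
          ∀ ℋ : (FieldTheory.E n × FieldTheory.E m) × FieldTheory.MomCoord n m → ℝ,
            FieldTheory.IsLocalHamiltonian c H.toFun ℋ →
            FieldTheory.contract (FieldTheory.dLag ℒ (c.tot y) (c.jetCoord Γ)) (c.jetCoord Γ)
                - ℒ (c.tot y, c.jetCoord Γ)
              = ℋ (c.tot y, FieldTheory.dLag ℒ (c.tot y) (c.jetCoord Γ))) := by
  have main := fun H (hH : FieldTheory.HamiltonianForm.IsAssociated H L)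
      (c : FieldTheory.FibredChart n m π)
      (ℒ : (FieldTheory.E n × FieldTheory.E m) × FieldTheory.JetCoord n m → ℝ)
      (hℒ : FieldTheory.IsLocalLagrangian c L.toFun ℒ) y (hy : y ∈ c.tot.source)
      (Γ : FieldTheory.Jet π y) => hH.toFun_legendre hL hℒ hy Γ
  constructor
  -- A point of `Q` is `L̂(Γ)` for some `Γ`, and both forms equal the same expression in `Γ` and
  -- `ℒ`.
  · rintro H H' hH hH' - ⟨⟨y, Γ⟩, rfl⟩
    obtain ⟨c, hy⟩ := FieldTheory.exists_fibredChart hπ y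
    obtain ⟨ℒ, hℒ⟩ := L.smooth c
    exact (main H hH c ℒ hℒ y hy Γ).trans (main H' hH' c ℒ hℒ y hy Γ).symm
  · intro H hH c ℒ hℒ y hy Γ
    have h := main H hH c ℒ hℒ y hy Γ
    refine ⟨?_, fun ℋ hℋ => ?_⟩
    · rw [h, c.momCoord_legendre hy hℒ, ← c.formOf_add_smul_vol]
      rfl
    · rw [hℋ.2 y hy, c.momCoord_legendre hy hℒ] at h
      exact (c.formOf_injective hy _ h).symm
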